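/- Let $(X,\|\cdot\|)$ be a real Banach space, $C\subseteq X$ a closed set, $x_0\in X\setminus C$ and $y\in C$. Let $r_0>0$ and $L>0$, write $B(x,r)$ for the open ball with centre $x$ and radius $r$, and suppose that $f_y(x)=\|x-y\|$ is Fréchet differentiable at every point of $B(x_0,r_0)$ with $$\|f_y'(x_1)-f_y'(x_2)\|_{X^*}\le L\|x_1-x_2\|\qquad\text{for all }x_1,x_2\in B(x_0,r_0).$$ (1) The norm is Lipschitz smooth at every point $z$ of $B(x_0-y,r_0)$; that is, for each such $z$ there is $K_z\in(0,\infty)$ such that $$\frac{\|z+\tau u\|}{2}+\frac{\|z-\tau u\|}{2}\le \|z\|+K_z\tau^2\qquad\text{for all }u\in X\text{ with }\|u\|=1\text{ and all }\tau>0.$$ (2) Suppose in addition that there is a function $F:X\to\mathbb R$, Fréchet differentiable at every point of $B(x_0,r_0)$, such that $$\big(F'(x_1)-F'(x_2)\big)(x_1-x_2)\ge L\|x_1-x_2\|^2\qquad\text{for all }x_1,x_2\in B(x_0,r_0).$$ Then $X$ admits an equivalent norm $|\cdot|$ which is $2$-uniformly convex, i.e. there is $c>0$ with $1-\left|\frac{u+v}{2}\right|\ge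 c\,|u-v|^2$ whenever $|u|=|v|=1$. In particular, if $X$ is infinite-dimensional and is (linearly isometric to) a real space $L_p(\mu)$ for some measure $\mu$ and some $p\in[1,\infty]$, then $p=2$. -/

import Mathlib

/-- The norm of `X` is Lipschitz smooth at the point `x`: there is a constant `K ∈ (0, ∞)` with
`(‖x + τ u‖ + ‖x - τ u‖) / 2 ≤ ‖x‖ + K τ ^ 2` for all unit vectors `u` and all `τ > 0`. -/
def NormLipschitzSmoothAt {X : Type*} [NormedAddCommGroup X] [NormedSpace ℝ X] (x : X) : Prop :=
  ∃ K : ℝ, 0 < K ∧ ∀ u : X, ‖u‖ = 1 → ∀ τ : ℝ, 0 < τ →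
    ‖x + τ • u‖ / 2 + ‖x - τ • u‖ / 2 ≤ ‖x‖ + K * τ ^ 2

/-- `N` is a norm on `X` equivalent to the given one. The lower bound makes the seminorm `N`
a norm. -/
def IsEquivalentNorm {X : Type*} [NormedAddCommGroup X] [NormedSpace ℝ X]
    (N : Seminorm ℝ X) : Prop :=
  ∃ a b : ℝ, 0 < a ∧ 0 < b ∧ ∀ x : X, a * ‖x‖ ≤ N x ∧ N x ≤ b * ‖x‖

/-- The norm `N` is `2`-uniformly convex: for some constant `c > 0`, all `x`, `y` in its unit
sphere satisfy `1 - N ((x + y) / 2) ≥ c * N (x - y) ^ 2`. -/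
def IsTwoUniformlyConvex {X : Type*} [AddCommGroup X] [Module ℝ X]
    (N : Seminorm ℝ X) : Prop :=
  ∃ c : ℝ, 0 < c ∧ ∀ x y : X, N x = 1 → N y = 1 →
    c * N (x - y) ^ 2 ≤ 1 - N ((1 / 2 : ℝ) • (x + y))

/-- `f` is Fréchet differentiable at every point of `S`, and its derivative is `L`-Lipschitz
on `S` for the operator norm. -/
def HasLipschitzDerivOn {X : Type*} [NormedAddCommGroup X] [NormedSpace ℝ X]
    (f : X → ℝ) (L : ℝ) (S : Set X) : Prop :=
  (∀ x ∈ S, DifferentiableAt ℝ f x) ∧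
    ∀ x₁ ∈ S, ∀ x₂ ∈ S, ‖fderiv ℝ f x₁ - fderiv ℝ f x₂‖ ≤ L * ‖x₁ - x₂‖

/-- `F` is Fréchet differentiable at every point of `S`, and its derivative is strongly monotone
on `S` with constant `L`. -/
def HasStronglyMonotoneDerivOn {X : Type*} [NormedAddCommGroup X] [NormedSpace ℝ X]
    (F : X → ℝ) (L : ℝ) (S : Set X) : Prop :=
  (∀ x ∈ S, DifferentiableAt ℝ F x) ∧
    ∀ x₁ ∈ S, ∀ x₂ ∈ S, L * ‖x₁ - x₂‖ ^ 2 ≤ (fderiv ℝ F x₁ - fderiv ℝ F x₂) (x₁ - x₂)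

/-! A Lipschitz derivative makes second differences of the norm at most `2 * L * ‖h‖ ^ 2` near `x₀ -
y`; this is (1). A strongly monotone derivative makes second differences of `F` at least `L * ‖h‖ ^
2` near `x₀`.

Renorming: symmetrizing `F` about `x₀` gives an even convex `G` with `L * ‖x‖ ^ 2 ≤ G x`. A small
sublevel set of `G` is a bounded symmetric convex body. By strong midpoint convexity, midpoints of
chords lie inside it at a depth quadratic in the chord, so its gauge is 2-uniformly convex
(`exists_isTwoUniformlyConvex_of_convexOn`).

Exponent: an infinite-dimensional `Lp` contains infinitely many disjoint unit vectors. Add `n` of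
them, scaled by a multiple of `n ^ (-1/p)`, with signs chosen greedily: the sum stays bounded, while
the accumulated second-order terms have size `n ^ (1 - 2/p)`. For `p > 2` the values of `F` would be
unbounded on a ball where they are bounded above. For `p < 2` the norm would barely grow, although
its `p`-th power grows by a fixed amount. -/

open Metric Set Filter Topology

/-! ### Second differences of a norm with Lipschitz derivative -/

section Smooth

variable {X : Type*} [NormedAddCommGroup X] [NormedSpace ℝ X]

/-- Mean value inequality on a ball where the derivative differs from the one at `z` by at most `L *
‖h‖`. The sharp constant `L / 2` is not needed. -/
theorem abs_sub_sub_fderiv_le_of_lipschitzDeriv {f : X → ℝ} {L : ℝ} (hL : 0 ≤ L) {S : Set X}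
    (hf : HasLipschitzDerivOn f L S) {z h : X} (hz : closedBall z ‖h‖ ⊆ S) :
    |f (z + h) - f z - fderiv ℝ f z h| ≤ L * ‖h‖ ^ 2 := by
  have hzS : z ∈ S := hz (mem_closedBall_self (norm_nonneg h))
  have key := (convex_closedBall z ‖h‖).norm_image_sub_le_of_norm_fderiv_le' (𝕜 := ℝ) (f := f)
    (φ := fderiv ℝ f z) (C := L * ‖h‖) (x := z) (y := z + h)
    (fun x hx => hf.1 x (hz hx))
    (fun x hx => (hf.2 x (hz hx) z hzS).trans
      (mul_le_mul_of_nonneg_left (mem_closedBall_iff_norm.1 hx) hL))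
    (mem_closedBall_self (norm_nonneg h)) (by simp)
  simp only [add_sub_cancel_left, Real.norm_eq_abs] at key
  calc _ ≤ L * ‖h‖ * ‖h‖ := key
    _ = _ := by ring

theorem HasLipschitzDerivOn.comp_sub_const {f : X → ℝ} {L r : ℝ} {x₀ y : X}
    (hf : HasLipschitzDerivOn (fun x => f (x - y)) L (ball x₀ r)) :
    HasLipschitzDerivOn f L (ball (x₀ - y) r) := by
  have hball : ∀ z ∈ ball (x₀ - y) r, z + y ∈ ball x₀ r := fun z hz => by
    rw [mem_ball_iff_norm] at hz ⊢
    rwa [show z + y - x₀ = z - (x₀ - y) by abel]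
  have hfd : ∀ z, fderiv ℝ (fun x => f (x - y)) (z + y) = fderiv ℝ f z := fun z => by
    rw [fderiv_comp_sub, add_sub_cancel_right]
  refine ⟨fun z hz => ?_, fun z₁ h₁ z₂ h₂ => ?_⟩
  · have := hf.1 _ (hball z hz)
    have h2 := DifferentiableAt.comp (f := fun w => w + y) (g := fun x => f (x - y)) z this
      (by fun_prop)
    simpa [Function.comp_def] using h2
  · have := hf.2 _ (hball z₁ h₁) _ (hball z₂ h₂)
    rwa [hfd, hfd, add_sub_add_right_eq_sub] at this

theorem norm_add_add_norm_sub_le {L : ℝ} (hL : 0 ≤ L) {S : Set X}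
    (hf : HasLipschitzDerivOn (fun x : X => ‖x‖) L S) {z h : X} (hz : closedBall z ‖h‖ ⊆ S) :
    ‖z + h‖ + ‖z - h‖ ≤ 2 * ‖z‖ + 2 * L * ‖h‖ ^ 2 := by
  have h1 := (abs_le.1 (abs_sub_sub_fderiv_le_of_lipschitzDeriv hL hf hz)).2
  have h2 := (abs_le.1 (abs_sub_sub_fderiv_le_of_lipschitzDeriv hL hf (z := z) (h := -h)
    (by simpa using hz))).2
  simp only [map_neg, norm_neg, ← sub_eq_add_neg] at h2
  linarith

theorem normLipschitzSmoothAt_of_hasLipschitzDerivOn {L : ℝ} (hL : 0 < L) {S : Set X}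
    (hS : IsOpen S) (hf : HasLipschitzDerivOn (fun x : X => ‖x‖) L S) {z : X} (hz : z ∈ S) :
    NormLipschitzSmoothAt z := by
  obtain ⟨δ, hδ, hδS⟩ := nhds_basis_closedBall.mem_iff.1 (hS.mem_nhds hz)
  -- `L` serves `τ ≤ δ`; for `τ ≥ δ` the triangle inequality leaves an excess `τ ≤ τ ^ 2 / δ`.
  refine ⟨L + 1 / δ, by positivity, fun u hu τ hτ => ?_⟩
  have hn : ‖τ • u‖ = τ := by rw [norm_smul, hu, mul_one, Real.norm_of_nonneg hτ.le]
  rcases le_total τ δ with h | h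
  · have := norm_add_add_norm_sub_le hL.le hf (z := z) (h := τ • u)
      ((closedBall_subset_closedBall (hn.trans_le h)).trans hδS)
    rw [hn] at this
    have h3 : 0 ≤ 1 / δ * τ ^ 2 := by positivity
    linarith
  · have h1 := norm_add_le z (τ • u)
    have h2 := norm_sub_le z (τ • u)
    rw [hn] at h1 h2
    have h3 : τ ≤ 1 / δ * τ ^ 2 := by
      rw [one_div, inv_mul_eq_div, le_div_iff₀ hδ, sq]
      exact mul_le_mul_of_nonneg_left h hτ.le
    have h4 : 0 ≤ L * τ ^ 2 := by positivity
    linarith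

end Smooth

/-! ### Strong convexity and the renorming -/

section StronglyConvex

variable {X : Type*} [NormedAddCommGroup X] [NormedSpace ℝ X]

/-- Along the segment, `F` minus its tangent and minus the quadratic term is nondecreasing: strong
monotonicity for the pair `a + t • (b - a)`, `a`, divided by `t`, says its derivative is
nonnegative. -/
theorem HasStronglyMonotoneDerivOn.add_fderiv_add_le {F : X → ℝ} {L : ℝ} {S : Set X}
    (hS : Convex ℝ S) (hF : HasStronglyMonotoneDerivOn F L S) {a b : X} (ha : a ∈ S) (hb : b ∈ S) :
    F a + fderiv ℝ F a (b - a) + L / 2 * ‖b - a‖ ^ 2 ≤ F b := by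
  have hmem : ∀ t ∈ Icc (0 : ℝ) 1, a + t • (b - a) ∈ S := fun t ht =>
    hS.add_smul_sub_mem ha hb ht
  have hline : ∀ t : ℝ, HasDerivAt (fun t : ℝ => a + t • (b - a)) (b - a) t := fun t => by
    simpa using ((hasDerivAt_id t).smul_const (b - a)).const_add a
  have hder : ∀ t ∈ Icc (0 : ℝ) 1, HasDerivAt
      (fun t : ℝ => F (a + t • (b - a)) - t * fderiv ℝ F a (b - a) - L / 2 * ‖b - a‖ ^ 2 * t ^ 2)
      (fderiv ℝ F (a + t • (b - a)) (b - a) - fderiv ℝ F a (b - a) - L * ‖b - a‖ ^ 2 * t) t := by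
    intro t ht
    have h1 := (hF.1 _ (hmem t ht)).hasFDerivAt.comp_hasDerivAt t (hline t)
    have h2 := (hasDerivAt_id t).mul_const (fderiv ℝ F a (b - a))
    have h3 := ((hasDerivAt_id t).pow 2).const_mul (L / 2 * ‖b - a‖ ^ 2)
    refine ((h1.sub h2).sub h3).congr_deriv ?_
    simp
    ring
  have hmono : MonotoneOn
      (fun t : ℝ => F (a + t • (b - a)) - t * fderiv ℝ F a (b - a) - L / 2 * ‖b - a‖ ^ 2 * t ^ 2)
      (Icc 0 1) := by
    refine monotoneOn_of_deriv_nonneg (convex_Icc 0 1)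
      (fun t ht => (hder t ht).continuousAt.continuousWithinAt)
      (fun t ht => (hder t (interior_subset ht)).differentiableAt.differentiableWithinAt)
      (fun t ht => ?_)
    rw [interior_Icc] at ht
    rw [(hder t (Ioo_subset_Icc_self ht)).deriv]
    have h := hF.2 _ (hmem t (Ioo_subset_Icc_self ht)) a ha
    rw [add_sub_cancel_left, map_smul, norm_smul, Real.norm_of_nonneg ht.1.le, smul_eq_mul] at h
    have h' : t * (L * ‖b - a‖ ^ 2 * t) ≤
        t * (fderiv ℝ F (a + t • (b - a)) (b - a) - fderiv ℝ F a (b - a)) := by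
      simp only [sub_apply] at h
      linarith
    have := le_of_mul_le_mul_left h' ht.1
    linarith
  have := hmono (left_mem_Icc.2 zero_le_one) (right_mem_Icc.2 zero_le_one) zero_le_one
  simp only [zero_smul, add_zero, zero_mul, one_smul, add_sub_cancel] at this
  linarith

theorem HasStronglyMonotoneDerivOn.two_mul_add_le {F : X → ℝ} {L : ℝ} {S : Set X}
    (hS : Convex ℝ S) (hF : HasStronglyMonotoneDerivOn F L S) {x h : X} (hx : x ∈ S)
    (h₁ : x + h ∈ S) (h₂ : x - h ∈ S) :
    2 * F x + L * ‖h‖ ^ 2 ≤ F (x + h) + F (x - h) := by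
  have h1 := hF.add_fderiv_add_le hS hx h₁
  have h2 := hF.add_fderiv_add_le hS hx h₂
  simp only [add_sub_cancel_left, sub_sub_cancel_left, map_neg, norm_neg] at h1 h2
  linarith

theorem HasStronglyMonotoneDerivOn.convexOn {F : X → ℝ} {L : ℝ} (hL : 0 ≤ L) {S : Set X}
    (hS : Convex ℝ S) (hF : HasStronglyMonotoneDerivOn F L S) : ConvexOn ℝ S F := by
  refine ⟨hS, fun a ha b hb s t hs ht hst => ?_⟩
  set m := s • a + t • b with hm
  have hmS : m ∈ S := hS ha hb hs ht hst
  have h1 := hF.add_fderiv_add_le hS hmS ha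
  have h2 := hF.add_fderiv_add_le hS hmS hb
  have h0 : s * fderiv ℝ F m (a - m) + t * fderiv ℝ F m (b - m) = 0 := by
    rw [← smul_eq_mul, ← smul_eq_mul, ← map_smul, ← map_smul, ← map_add]
    have : s • (a - m) + t • (b - m) = 0 := by
      rw [smul_sub, smul_sub, sub_add_sub_comm, ← add_smul, hst, one_smul, ← hm, sub_self]
    rw [this, map_zero]
  have h3 : 0 ≤ L / 2 * ‖a - m‖ ^ 2 := by positivity
  have h4 : 0 ≤ L / 2 * ‖b - m‖ ^ 2 := by positivity
  have h5 := mul_le_mul_of_nonneg_left (show F m + fderiv ℝ F m (a - m) ≤ F a by linarith) hs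
  have h6 := mul_le_mul_of_nonneg_left (show F m + fderiv ℝ F m (b - m) ≤ F b by linarith) ht
  have h7 : F m = s * F m + t * F m := by rw [← add_mul, hst, one_mul]
  simp only [smul_eq_mul]
  linarith

/-- A continuous even function that is strongly midpoint convex near the origin yields an
equivalent `2`-uniformly convex norm, namely the gauge of one of its sublevel sets. -/
theorem exists_isTwoUniformlyConvex_of_convexOn {G : X → ℝ} {L r : ℝ} (hL : 0 < L) (hr : 0 < r)
    (hconv : ConvexOn ℝ (ball 0 r) G) (hcont : ContinuousOn G (ball 0 r)) (hzero : G 0 = 0)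
    (heven : ∀ x, G (-x) = G x) (hbelow : ∀ x ∈ ball (0 : X) r, L * ‖x‖ ^ 2 ≤ G x)
    (hmid : ∀ x h : X, x ∈ ball (0 : X) r → x + h ∈ ball (0 : X) r → x - h ∈ ball (0 : X) r →
      2 * G x + L * ‖h‖ ^ 2 ≤ G (x + h) + G (x - h)) :
    ∃ N : Seminorm ℝ X, IsEquivalentNorm N ∧ IsTwoUniformlyConvex N := by
  have h0r : (0 : X) ∈ ball (0 : X) r := mem_ball_self hr
  have hc0 : ContinuousAt G 0 := hcont.continuousAt (isOpen_ball.mem_nhds h0r)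
  have hG0 : ∀ ε : ℝ, 0 < ε → ∃ δ > 0, closedBall (0 : X) δ ⊆ {x | G x ≤ ε} := fun ε hε =>
    nhds_basis_closedBall.mem_iff.1
      ((hc0.eventually (gt_mem_nhds (by rwa [hzero]))).mono fun x hx => hx.le)
  obtain ⟨δ, hδ, hδ1⟩ := hG0 1 one_pos
  -- `2 * ρ ≤ δ` gives `G ≤ 1` at the doubled midpoint, `2 * ρ < r` keeps that point in the domain,
  -- and `L * ρ ^ 2 ≤ 1` makes the dilation parameter `ε` at most 1.
  obtain ⟨ρ, hρ, hρδ, hρr, hρL⟩ : ∃ ρ : ℝ, 0 < ρ ∧ 2 * ρ ≤ δ ∧ 2 * ρ < r ∧ L * ρ ^ 2 ≤ 1 := by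
    have hev : ∀ᶠ ρ : ℝ in 𝓝[>] 0, 2 * ρ < δ ∧ 2 * ρ < r ∧ L * ρ ^ 2 < 1 := by
      apply eventually_nhdsWithin_of_eventually_nhds
      have e1 : Tendsto (fun ρ : ℝ => 2 * ρ) (𝓝 0) (𝓝 0) :=
        (by fun_prop : Continuous fun ρ : ℝ => 2 * ρ).tendsto' _ _ (by simp)
      have e2 : Tendsto (fun ρ : ℝ => L * ρ ^ 2) (𝓝 0) (𝓝 0) :=
        (by fun_prop : Continuous fun ρ : ℝ => L * ρ ^ 2).tendsto' _ _ (by simp)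
      filter_upwards [e1.eventually_lt_const hδ, e1.eventually_lt_const hr,
        e2.eventually_lt_const one_pos] with ρ a b c using ⟨a, b, c⟩
    obtain ⟨ρ, ⟨a, b, c⟩, h⟩ := (hev.and self_mem_nhdsWithin).exists
    exact ⟨ρ, h, a.le, b, c.le⟩
  have hsub : closedBall (0 : X) (2 * ρ) ⊆ ball 0 r := closedBall_subset_ball hρr
  -- The level forces `‖x‖ ≤ ρ`, so the cut at radius `2 * ρ` never binds; it only keeps `B` in the
  -- region where `G` is controlled.
  set B : Set X := {x ∈ closedBall (0 : X) (2 * ρ) | G x ≤ L * ρ ^ 2} with hB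
  have hBball : ∀ x ∈ B, ‖x‖ ≤ ρ := fun x hx => by
    have h1 := (hbelow x (hsub hx.1)).trans hx.2
    exact le_of_sq_le_sq (le_of_mul_le_mul_left h1 hL) hρ.le
  have hBconv : Convex ℝ B :=
    (hconv.subset hsub (convex_closedBall _ _)).convex_le _
  have hBclosed : IsClosed B :=
    (hcont.mono hsub).preimage_isClosed_of_isClosed isClosed_closedBall isClosed_Iic
  have hBneg : ∀ x ∈ B, -x ∈ B := fun x hx => ⟨by simpa using hx.1, by
    rw [heven]; exact hx.2⟩
  obtain ⟨η₀, hη₀, hη₀B⟩ := hG0 (L * ρ ^ 2) (by positivity)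
  obtain ⟨η, hη, hηB⟩ : ∃ η > 0, ball (0 : X) η ⊆ B := by
    refine ⟨min η₀ (2 * ρ), by positivity, fun x hx => ?_⟩
    rw [mem_ball_zero_iff, lt_min_iff] at hx
    exact ⟨mem_closedBall_zero_iff.2 hx.2.le, hη₀B (mem_closedBall_zero_iff.2 hx.1.le)⟩
  have hBnhds : B ∈ 𝓝 (0 : X) := mem_of_superset (ball_mem_nhds 0 hη) hηB
  have hBabs : Absorbent ℝ B := absorbent_nhds_zero hBnhds
  have hBbal : Balanced ℝ B := by
    rw [balanced_iff_neg_mem hBconv]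
    exact fun {x} hx => hBneg x hx
  set N : Seminorm ℝ X := gaugeSeminorm hBbal hBconv hBabs with hN
  have hNg : ∀ x, N x = gauge B x := fun x => rfl
  have hNle : ∀ x, N x ≤ η⁻¹ * ‖x‖ := fun x => by
    rw [hNg, ← div_eq_inv_mul, le_div_iff₀ hη, mul_comm]
    exact mul_gauge_le_norm hηB
  have hleN : ∀ x, ρ⁻¹ * ‖x‖ ≤ N x := fun x => by
    rw [hNg, ← div_eq_inv_mul]
    exact le_gauge_of_subset_closedBall hBabs hρ.le
      fun x hx => mem_closedBall_zero_iff.2 (hBball x hx)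
  refine ⟨N, ⟨ρ⁻¹, η⁻¹, by positivity, by positivity, fun x => ⟨hleN x, hNle x⟩⟩,
    L * η ^ 2 / 16, by positivity, fun u v hu hv => ?_⟩
  have hmem : ∀ x, N x = 1 → x ∈ B := fun x hx => by
    rw [← hBclosed.closure_eq, ← gauge_le_one_iff_mem_closure hBconv hBnhds, ← hNg, hx]
  have huB := hmem u hu
  have hvB := hmem v hv
  set w : X := (1 / 2 : ℝ) • (u + v) with hw
  set h : X := (1 / 2 : ℝ) • (u - v) with hh
  have hwu : w + h = u := by rw [hw, hh]; module
  have hwv : w - h = v := by rw [hw, hh]; module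
  have hwρ : ‖w‖ ≤ ρ := by
    rw [hw, norm_smul, Real.norm_of_nonneg (by norm_num)]
    linarith [norm_add_le u v, hBball u huB, hBball v hvB]
  have hhρ : ‖h‖ ≤ ρ := by
    rw [hh, norm_smul, Real.norm_of_nonneg (by norm_num)]
    linarith [norm_sub_le u v, hBball u huB, hBball v hvB]
  have hwr : w ∈ ball (0 : X) r := mem_ball_zero_iff.2 (by linarith)
  have h2w : (2 : ℝ) • w ∈ closedBall (0 : X) (2 * ρ) := by
    rw [mem_closedBall_zero_iff, norm_smul, Real.norm_of_nonneg zero_le_two]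
    linarith
  have hGw : 2 * G w + L * ‖h‖ ^ 2 ≤ G u + G v := by
    have := hmid w h hwr (hwu ▸ hsub huB.1) (hwv ▸ hsub hvB.1)
    rwa [hwu, hwv] at this
  -- Since `G w ≤ L * ρ ^ 2 - ε` and `G (2 • w) ≤ 1`, moving from `w` a fraction `ε` of the way to
  -- `2 • w` stays in `B`. Hence `N w ≤ 1 / (1 + ε)`.
  set ε : ℝ := L * ‖h‖ ^ 2 / 2 with hε
  have hε0 : 0 ≤ ε := by positivity
  have hε1 : ε ≤ 1 := by
    have : L * ‖h‖ ^ 2 ≤ L * ρ ^ 2 := by gcongr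
    linarith
  have hG2w : G ((2 : ℝ) • w) ≤ 1 := hδ1 (closedBall_subset_closedBall hρδ h2w)
  have hGw0 : 0 ≤ G w := le_trans (by positivity) (hbelow w hwr)
  have hdil : (1 + ε) • w ∈ B := by
    have heq : (1 + ε) • w = (1 - ε) • w + ε • (2 : ℝ) • w := by module
    refine ⟨?_, ?_⟩
    · rw [mem_closedBall_zero_iff, norm_smul, Real.norm_of_nonneg (by linarith)]
      exact mul_le_mul (by linarith) hwρ (norm_nonneg _) zero_le_two
    · have hc := hconv.2 hwr (hsub h2w) (sub_nonneg.2 hε1) hε0 (by ring)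
      rw [← heq, smul_eq_mul, smul_eq_mul] at hc
      have h1 : ε * G ((2 : ℝ) • w) ≤ ε * 1 := mul_le_mul_of_nonneg_left hG2w hε0
      have h2 : 0 ≤ ε * G w := mul_nonneg hε0 hGw0
      linarith [huB.2, hvB.2]
  have hNw : (1 + ε) * N w ≤ 1 := by
    have h1 : N ((1 + ε) • w) ≤ 1 := gauge_le_one_of_mem hdil
    rwa [map_smul_eq_mul, Real.norm_of_nonneg (by linarith)] at h1
  have hNuv : η ^ 2 * N (u - v) ^ 2 ≤ 4 * ‖h‖ ^ 2 := by
    have h1 := hNle (u - v)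
    have h2 : u - v = (2 : ℝ) • h := by rw [hh]; module
    rw [inv_mul_eq_div, le_div_iff₀ hη, h2, norm_smul, Real.norm_of_nonneg zero_le_two, ← h2] at h1
    have h3 := pow_le_pow_left₀ (mul_nonneg (apply_nonneg N _) hη.le) h1 2
    linarith [mul_pow (N (u - v)) η 2, mul_pow 2 ‖h‖ 2]
  have hfin : ε / 2 ≤ 1 - N w := by
    nlinarith [apply_nonneg N w]
  have : L * (η ^ 2 * N (u - v) ^ 2) ≤ L * (4 * ‖h‖ ^ 2) := mul_le_mul_of_nonneg_left hNuv hL.le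
  change L * η ^ 2 / 16 * N (u - v) ^ 2 ≤ 1 - N w
  linarith

theorem HasStronglyMonotoneDerivOn.exists_isTwoUniformlyConvex {F : X → ℝ} {L r : ℝ} {x₀ : X}
    (hL : 0 < L) (hr : 0 < r) (hF : HasStronglyMonotoneDerivOn F L (ball x₀ r)) :
    ∃ N : Seminorm ℝ X, IsEquivalentNorm N ∧ IsTwoUniformlyConvex N := by
  have hS := convex_ball x₀ r
  have hadd : ∀ x ∈ ball (0 : X) r, x₀ + x ∈ ball x₀ r := fun x hx => by
    simpa [mem_ball_iff_norm] using hx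
  have hsub : ∀ x ∈ ball (0 : X) r, x₀ - x ∈ ball x₀ r := fun x hx => by
    simpa [mem_ball_iff_norm] using hx
  have hcv := hF.convexOn hL.le hS
  have hct : ContinuousOn F (ball x₀ r) := fun x hx =>
    (hF.1 x hx).continuousAt.continuousWithinAt
  -- Symmetrizing removes the linear part of `F` at `x₀`; the second difference there bounds `G`
  -- below.
  refine exists_isTwoUniformlyConvex_of_convexOn
    (G := fun x => F (x₀ + x) + F (x₀ - x) - 2 * F x₀) hL hr
    ⟨convex_ball 0 r, fun a ha b hb s t hs ht hst => ?_⟩ ?_ (by simp; ring)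
    (fun x => by simp only [sub_neg_eq_add, ← sub_eq_add_neg]; ring) (fun x hx => ?_)
    (fun x h hx h₁ h₂ => ?_)
  · have h1 := hcv.2 (hadd a ha) (hadd b hb) hs ht hst
    have h2 := hcv.2 (hsub a ha) (hsub b hb) hs ht hst
    have e1 : s • (x₀ + a) + t • (x₀ + b) = x₀ + (s • a + t • b) := by
      rw [show x₀ + (s • a + t • b) = (1 : ℝ) • x₀ + (s • a + t • b) by rw [one_smul], ← hst]
      module
    have e2 : s • (x₀ - a) + t • (x₀ - b) = x₀ - (s • a + t • b) := by
      rw [show x₀ - (s • a + t • b) = (1 : ℝ) • x₀ - (s • a + t • b) by rw [one_smul], ← hst]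
      module
    rw [e1] at h1
    rw [e2] at h2
    simp only [smul_eq_mul] at h1 h2 ⊢
    have h3 : 2 * F x₀ = s * (2 * F x₀) + t * (2 * F x₀) := by rw [← add_mul, hst, one_mul]
    linarith
  · exact ((hct.comp (by fun_prop) hadd).add (hct.comp (by fun_prop) hsub)).sub
      continuousOn_const
  · have := hF.two_mul_add_le hS (mem_ball_self hr) (hadd x hx) (hsub x hx)
    linarith
  · have h1 := hF.two_mul_add_le hS (h := h) (hadd x hx) (by simpa [add_assoc] using hadd _ h₁)
      (by simpa [add_sub_assoc] using hadd _ h₂)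
    have h2 := hF.two_mul_add_le hS (h := h) (hsub x hx)
      (by simpa [sub_sub_eq_add_sub, sub_add] using hsub _ h₂)
      (by simpa [sub_sub] using hsub _ h₁)
    have e1 : x₀ + (x + h) = x₀ + x + h := by abel
    have e2 : x₀ + (x - h) = x₀ + x - h := by abel
    have e3 : x₀ - (x + h) = x₀ - x - h := by abel
    have e4 : x₀ - (x - h) = x₀ - x + h := by abel
    simp only [e1, e2, e3, e4]
    have : 0 ≤ L * ‖h‖ ^ 2 := by positivity
    linarith

end StronglyConvex

/-! ### Totally ordered subspaces of a normed lattice -/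

section TotallyOrdered

/-- For `g > 0` in `V`, the closed sets of `t` with `f - t • g ≥ 0` and with `f - t • g ≤ 0` cover
the line. Both are nonempty because a solid norm makes the order Archimedean, so by connectedness
they meet, and there `f = t • g`. -/
theorem Submodule.exists_le_span_singleton_of_forall_nonneg_or_nonpos {E : Type*}
    [NormedAddCommGroup E] [NormedSpace ℝ E] [Lattice E] [HasSolidNorm E] [IsOrderedAddMonoid E]
    (V : Submodule ℝ E) (hV : ∀ f ∈ V, 0 ≤ f ∨ f ≤ 0) : ∃ g, V ≤ Submodule.span ℝ {g} := by
  by_cases hbot : V = ⊥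
  · exact ⟨0, hbot ▸ bot_le⟩
  obtain ⟨g, hgV, hg0, hg⟩ : ∃ g ∈ V, g ≠ 0 ∧ 0 ≤ g := by
    obtain ⟨f, hfV, hf0⟩ := V.ne_bot_iff.1 hbot
    rcases hV f hfV with h | h
    · exact ⟨f, hfV, hf0, h⟩
    · exact ⟨-f, V.neg_mem hfV, neg_ne_zero.2 hf0, neg_nonneg.2 h⟩
  have harch : ∀ f : E, ∃ n : ℕ, ¬ n • g ≤ f := fun f => by
    by_contra! h
    obtain ⟨n, hn⟩ := exists_nat_gt (‖f‖ / ‖g‖)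
    rw [div_lt_iff₀ (norm_pos_iff.2 hg0)] at hn
    have h0 : 0 ≤ n • g := nsmul_nonneg hg n
    have h1 : ‖n • g‖ ≤ ‖f‖ := norm_le_norm_of_abs_le_abs (by
      rw [abs_of_nonneg h0, abs_of_nonneg (h0.trans (h n))]
      exact h n)
    rw [← Nat.cast_smul_eq_nsmul ℝ, norm_smul, Real.norm_natCast] at h1
    linarith
  refine ⟨g, fun f hf => ?_⟩
  have hmem : ∀ t : ℝ, f - t • g ∈ V := fun t => V.sub_mem hf (V.smul_mem t hgV)
  have hcont : Continuous fun t : ℝ => f - t • g := by fun_prop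
  obtain ⟨t, -, h1, h2⟩ := isPreconnected_closed_iff.1 isPreconnected_univ
    {t : ℝ | 0 ≤ f - t • g} {t : ℝ | f - t • g ≤ 0}
    (isClosed_le continuous_const hcont) (isClosed_le hcont continuous_const)
    (fun t _ => hV _ (hmem t))
    (by
      obtain ⟨n, hn⟩ := harch (-f)
      refine ⟨-n, mem_univ _, (hV _ (hmem _)).resolve_right fun h => hn ?_⟩
      rw [neg_smul, sub_neg_eq_add, Nat.cast_smul_eq_nsmul] at h
      rwa [le_neg_iff_add_nonpos_left])
    (by
      obtain ⟨n, hn⟩ := harch f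
      refine ⟨n, mem_univ _, (hV _ (hmem _)).resolve_left fun h => hn ?_⟩
      rwa [Nat.cast_smul_eq_nsmul, sub_nonneg] at h)
  exact Submodule.mem_span_singleton.2 ⟨t, (sub_eq_zero.1 (le_antisymm h2 h1)).symm⟩

end TotallyOrdered

/-! ### Disjoint vectors in `Lp` -/

section DisjointLp

open MeasureTheory

variable {Ω : Type*} [MeasurableSpace Ω] {μ : Measure Ω} {p : ENNReal}

/-- Two elements of `Lp` whose supports are disjoint up to a null set. -/
def LpDisjoint (f g : Lp ℝ p μ) : Prop := ∀ᵐ x ∂μ, f x = 0 ∨ g x = 0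

theorem LpDisjoint.symm {f g : Lp ℝ p μ} (h : LpDisjoint f g) : LpDisjoint g f :=
  h.mono fun _ => Or.symm

theorem LpDisjoint.zero_right (f : Lp ℝ p μ) : LpDisjoint f 0 := by
  filter_upwards [Lp.coeFn_zero ℝ p μ] with x hx using Or.inr hx

theorem LpDisjoint.add_right {f g h : Lp ℝ p μ} (hg : LpDisjoint f g) (hh : LpDisjoint f h) :
    LpDisjoint f (g + h) := by
  filter_upwards [hg, hh, Lp.coeFn_add g h] with x h1 h2 h3
  rw [h3, Pi.add_apply]
  rcases h1 with h1 | h1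
  · exact Or.inl h1
  · exact h2.imp_right fun h2 => by rw [h1, h2, add_zero]

theorem LpDisjoint.smul_right {f g : Lp ℝ p μ} (h : LpDisjoint f g) (c : ℝ) :
    LpDisjoint f (c • g) := by
  filter_upwards [h, Lp.coeFn_smul c g] with x h1 h2
  rw [h2, Pi.smul_apply]
  exact h1.imp_right fun h1 => by rw [h1, smul_zero]

theorem LpDisjoint.neg_right {f g : Lp ℝ p μ} (h : LpDisjoint f g) : LpDisjoint f (-g) := by
  simpa using h.smul_right (-1)

theorem LpDisjoint.sum_right {ι : Type*} {f : Lp ℝ p μ} {g : ι → Lp ℝ p μ} {s : Finset ι}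
    (h : ∀ i ∈ s, LpDisjoint f (g i)) : LpDisjoint f (∑ i ∈ s, g i) :=
  Finset.sum_induction g (LpDisjoint f) (fun _ _ => LpDisjoint.add_right)
    (LpDisjoint.zero_right f) h

theorem Lp.exists_ae_eq_indicator (f : Lp ℝ p μ) {A : Set Ω} (hA : MeasurableSet A) :
    ∃ g : Lp ℝ p μ, g =ᵐ[μ] A.indicator f :=
  ⟨((Lp.memLp f).indicator hA).toLp, MemLp.coeFn_toLp _⟩

theorem Lp.norm_rpow_eq_toReal_lintegral [Fact (1 ≤ p)] (hp : p ≠ ⊤) (f : Lp ℝ p μ) :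
    ‖f‖ ^ p.toReal = (∫⁻ x, ‖f x‖ₑ ^ p.toReal ∂μ).toReal := by
  have hp0 : p ≠ 0 := (zero_lt_one.trans_le (Fact.out : 1 ≤ p)).ne'
  have hpr : p.toReal ≠ 0 := (ENNReal.toReal_pos hp0 hp).ne'
  rw [Lp.norm_def, ENNReal.toReal_rpow, eLpNorm_eq_lintegral_rpow_enorm_toReal hp0 hp,
    ← ENNReal.rpow_mul, one_div, inv_mul_cancel₀ hpr, ENNReal.rpow_one]

theorem Lp.lintegral_rpow_ne_top [Fact (1 ≤ p)] (hp : p ≠ ⊤) (f : Lp ℝ p μ) :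
    ∫⁻ x, ‖f x‖ₑ ^ p.toReal ∂μ ≠ ⊤ := by
  have hp0 : p ≠ 0 := (zero_lt_one.trans_le (Fact.out : 1 ≤ p)).ne'
  exact (lintegral_rpow_enorm_lt_top_of_eLpNorm_lt_top hp0 hp (Lp.eLpNorm_lt_top f)).ne

theorem LpDisjoint.norm_add_rpow [Fact (1 ≤ p)] (hp : p ≠ ⊤) {f g : Lp ℝ p μ}
    (h : LpDisjoint f g) :
    ‖f + g‖ ^ p.toReal = ‖f‖ ^ p.toReal + ‖g‖ ^ p.toReal := by
  have hp0 : p ≠ 0 := (zero_lt_one.trans_le (Fact.out : 1 ≤ p)).ne'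
  have hpr : 0 < p.toReal := ENNReal.toReal_pos hp0 hp
  simp only [Lp.norm_rpow_eq_toReal_lintegral hp]
  rw [← ENNReal.toReal_add (Lp.lintegral_rpow_ne_top hp f) (Lp.lintegral_rpow_ne_top hp g),
    ← lintegral_add_left' ((Lp.aestronglyMeasurable f).enorm.pow_const _)]
  congr 1
  refine lintegral_congr_ae ?_
  filter_upwards [h, Lp.coeFn_add f g] with x h1 h2
  rw [h2, Pi.add_apply]
  rcases h1 with h1 | h1 <;> simp [h1, ENNReal.zero_rpow_of_pos hpr]

theorem LpDisjoint.norm_add_le_max {f g : Lp ℝ ⊤ μ} (h : LpDisjoint f g) :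
    ‖f + g‖ ≤ max ‖f‖ ‖g‖ := by
  have hle : ∀ f : Lp ℝ ⊤ μ, ∀ᵐ x ∂μ, ‖f x‖ ≤ ‖f‖ := fun f => by
    have h1 := ae_le_eLpNormEssSup (f := f) (μ := μ)
    filter_upwards [h1] with x hx
    rw [Lp.norm_def, eLpNorm_exponent_top, ← toReal_enorm]
    exact ENNReal.toReal_mono (by simpa using Lp.eLpNorm_ne_top f) hx
  have h0 : 0 ≤ max ‖f‖ ‖g‖ := le_max_of_le_left (norm_nonneg f)
  rw [Lp.norm_def, eLpNorm_exponent_top]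
  refine ENNReal.toReal_le_of_le_ofReal h0 (eLpNormEssSup_le_of_ae_bound ?_)
  filter_upwards [h, hle f, hle g, Lp.coeFn_add f g] with x h1 h2 h3 h4
  rw [h4, Pi.add_apply]
  rcases h1 with h1 | h1
  · rw [h1, zero_add]
    exact h3.trans (le_max_right _ _)
  · rw [h1, add_zero]
    exact h2.trans (le_max_left _ _)

theorem norm_add_sum_rpow_of_lpDisjoint [Fact (1 ≤ p)] (hp : p ≠ ⊤) {ι : Type*}
    {z : Lp ℝ p μ} {g : ι → Lp ℝ p μ} {s : Finset ι} (hz : ∀ i ∈ s, LpDisjoint z (g i))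
    (hg : (s : Set ι).Pairwise fun i j => LpDisjoint (g i) (g j)) :
    ‖z + ∑ i ∈ s, g i‖ ^ p.toReal = ‖z‖ ^ p.toReal + ∑ i ∈ s, ‖g i‖ ^ p.toReal := by
  classical
  induction s using Finset.induction_on with
  | empty => simp
  | insert a s ha ih =>
    rw [Finset.coe_insert] at hg
    have h1 : LpDisjoint (g a) (∑ i ∈ s, g i) := LpDisjoint.sum_right fun i hi =>
      hg (mem_insert a _) (mem_insert_of_mem _ hi) (ne_of_mem_of_not_mem hi ha).symm
    have h2 : LpDisjoint (g a) z := (hz a (Finset.mem_insert_self a s)).symm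
    rw [Finset.sum_insert ha, Finset.sum_insert ha, add_left_comm,
      (h2.add_right h1).norm_add_rpow hp, ih (fun i hi => hz i (Finset.mem_insert_of_mem hi))
      (hg.mono (subset_insert _ _))]
    ring

/-- The elements of `Lp` that vanish almost everywhere off `A`. -/
def lpSupportedOn (p : ENNReal) (μ : Measure Ω) (A : Set Ω) : Submodule ℝ (Lp ℝ p μ) where
  carrier := {f | ∀ᵐ x ∂μ, x ∉ A → f x = 0}
  zero_mem' := by
    filter_upwards [Lp.coeFn_zero ℝ p μ] with x hx _ using hx
  add_mem' {f g} hf hg := by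
    filter_upwards [hf, hg, Lp.coeFn_add f g] with x h1 h2 h3 hx
    rw [h3, Pi.add_apply, h1 hx, h2 hx, add_zero]
  smul_mem' c f hf := by
    filter_upwards [hf, Lp.coeFn_smul c f] with x h1 h2 hx
    rw [h2, Pi.smul_apply, h1 hx, smul_zero]

theorem mem_lpSupportedOn {A : Set Ω} {f : Lp ℝ p μ} :
    f ∈ lpSupportedOn p μ A ↔ ∀ᵐ x ∂μ, x ∉ A → f x = 0 := Iff.rfl

theorem lpSupportedOn_univ : lpSupportedOn p μ univ = ⊤ :=
  eq_top_iff.2 fun _ _ => mem_lpSupportedOn.2 <|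
    Eventually.of_forall fun x hx => absurd (mem_univ x) hx

theorem lpSupportedOn_le_sup {A P : Set Ω} (hP : MeasurableSet P) :
    lpSupportedOn p μ A ≤ lpSupportedOn p μ (A ∩ P) ⊔ lpSupportedOn p μ (A \ P) := by
  intro f hf
  obtain ⟨g, hg⟩ := Lp.exists_ae_eq_indicator f hP
  refine Submodule.mem_sup.2 ⟨g, ?_, f - g, ?_, add_sub_cancel _ _⟩
  · filter_upwards [mem_lpSupportedOn.1 hf, hg] with x h1 h2 hx
    by_cases hxP : x ∈ P
    · rw [h2, indicator_of_mem hxP, h1 fun hxA => hx ⟨hxA, hxP⟩]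
    · rw [h2, indicator_of_notMem hxP]
  · filter_upwards [mem_lpSupportedOn.1 hf, hg, Lp.coeFn_sub f g] with x h1 h2 h3 hx
    rw [h3, Pi.sub_apply, h2]
    by_cases hxP : x ∈ P
    · rw [indicator_of_mem hxP, sub_self]
    · rw [indicator_of_notMem hxP, h1 fun hxA => hx ⟨hxA, hxP⟩, sub_zero]

/-- If no element changed sign, the space would be at most a line. Cut `A` by the positivity set of
a sign-changing `h`: one part still carries an infinite-dimensional space, the other a nonzero piece
of `h`. -/
theorem exists_split_lpSupportedOn [Fact (1 ≤ p)] {A : Set Ω} (hA : MeasurableSet A)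
    (hinf : ¬ FiniteDimensional ℝ (lpSupportedOn p μ A)) :
    ∃ B ⊆ A, MeasurableSet B ∧ ¬ FiniteDimensional ℝ (lpSupportedOn p μ B) ∧
      ∃ g ∈ lpSupportedOn p μ (A \ B), g ≠ 0 := by
  obtain ⟨h, hhA, hneg, hpos⟩ : ∃ h ∈ lpSupportedOn p μ A, ¬ 0 ≤ h ∧ ¬ h ≤ 0 := by
    by_contra! hcon
    obtain ⟨g, hg⟩ := Submodule.exists_le_span_singleton_of_forall_nonneg_or_nonpos
      (lpSupportedOn p μ A) fun f hf => or_iff_not_imp_left.2 (hcon f hf)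
    exact hinf (Submodule.finiteDimensional_of_le hg)
  set P : Set Ω := {x | 0 < h x} with hPdef
  have hP : MeasurableSet P :=
    measurableSet_lt measurable_const (Lp.stronglyMeasurable h).measurable
  have hne : ∀ Q : Set Ω, MeasurableSet Q → (¬ ∀ᵐ x ∂μ, x ∈ Q → h x = 0) →
      ∃ g ∈ lpSupportedOn p μ (A ∩ Q), g ≠ 0 := by
    intro Q hQ hQh
    obtain ⟨g, hg⟩ := Lp.exists_ae_eq_indicator h hQ
    refine ⟨g, ?_, fun hg0 => hQh ?_⟩
    · filter_upwards [mem_lpSupportedOn.1 hhA, hg] with x h1 h2 hx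
      rw [h2]
      by_cases hxQ : x ∈ Q
      · rw [indicator_of_mem hxQ, h1 fun hxA => hx ⟨hxA, hxQ⟩]
      · rw [indicator_of_notMem hxQ]
    · rw [hg0] at hg
      filter_upwards [hg, Lp.coeFn_zero ℝ p μ] with x h1 h2 hx
      rw [← indicator_of_mem hx h, ← h1, h2, Pi.zero_apply]
  by_cases hfd : FiniteDimensional ℝ (lpSupportedOn p μ (A \ P))
  · refine ⟨A ∩ P, inter_subset_left, hA.inter hP, fun hfd' => hinf ?_, ?_⟩
    · exact Submodule.finiteDimensional_of_le (lpSupportedOn_le_sup hP)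
    · rw [sdiff_self_inter]
      refine hne Pᶜ hP.compl fun hcon => hneg ((Lp.coeFn_nonneg h).1 ?_)
      filter_upwards [hcon] with x hx
      by_cases hxP : x ∈ P
      · exact (mem_ofPred.1 hxP).le
      · exact (hx hxP).ge
  · refine ⟨A \ P, sdiff_subset, hA.diff hP, hfd, ?_⟩
    rw [sdiff_sdiff_right_self]
    refine hne P hP fun hcon => hpos ((Lp.coeFn_le h 0).1 ?_)
    filter_upwards [hcon, Lp.coeFn_zero ℝ p μ] with x hx h0
    rw [h0]
    by_cases hxP : x ∈ P
    · exact (hx hxP).le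
    · exact not_lt.1 hxP

/-- Iterated splitting gives decreasing sets `A n`; the vectors live on the disjoint differences `A
n \ A (n + 1)`. -/
theorem exists_seq_lpDisjoint [Fact (1 ≤ p)] (hinf : ¬ FiniteDimensional ℝ (Lp ℝ p μ)) :
    ∃ g : ℕ → Lp ℝ p μ, (∀ i, ‖g i‖ = 1) ∧ Pairwise fun i j => LpDisjoint (g i) (g j) := by
  let T := {A : Set Ω // MeasurableSet A ∧ ¬ FiniteDimensional ℝ (lpSupportedOn p μ A)}
  have hstep : ∀ A : T, ∃ B : T, B.1 ⊆ A.1 ∧ ∃ g ∈ lpSupportedOn p μ (A.1 \ B.1), g ≠ 0 := by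
    rintro ⟨A, hA, hA'⟩
    obtain ⟨B, hBA, hB, hB', hg⟩ := exists_split_lpSupportedOn hA hA'
    exact ⟨⟨B, hB, hB'⟩, hBA, hg⟩
  choose next hnext w hw hw0 using hstep
  have huniv : ¬ FiniteDimensional ℝ (lpSupportedOn p μ univ) := fun h => hinf (by
    rw [lpSupportedOn_univ] at h
    exact Module.Finite.equiv (Submodule.topEquiv (R := ℝ) (M := Lp ℝ p μ)))
  let A : ℕ → T := fun n => next^[n] ⟨univ, MeasurableSet.univ, huniv⟩
  have hA : ∀ n, A (n + 1) = next (A n) := fun n => Function.iterate_succ_apply' _ _ _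
  have hanti : Antitone fun n => (A n).1 := antitone_nat_of_succ_le fun n => by
    rw [hA]
    exact hnext _
  have hlt : ∀ i j, i < j → LpDisjoint (w (A i)) (w (A j)) := fun i j hij => by
    filter_upwards [mem_lpSupportedOn.1 (hw (A i)), mem_lpSupportedOn.1 (hw (A j))] with x h1 h2
    by_cases hx : x ∈ (A j).1
    · refine Or.inl (h1 fun hx' => hx'.2 ?_)
      rw [← hA]
      exact hanti (Nat.succ_le_of_lt hij) hx
    · exact Or.inr (h2 fun hx' => hx hx'.1)
  refine ⟨fun n => ‖w (A n)‖⁻¹ • w (A n), fun n => ?_, fun i j hij => ?_⟩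
  · rw [norm_smul, norm_inv, norm_norm, inv_mul_cancel₀ (norm_ne_zero_iff.2 (hw0 _))]
  · refine ((LpDisjoint.smul_right ?_ _).symm.smul_right _).symm
    rcases hij.lt_or_gt with h | h
    · exact hlt i j h
    · exact (hlt j i h).symm

end DisjointLp

/-! ### Greedy choice of signs -/

section Signs

/-- The two signs gain `κ` on average, so one of them gains at least `κ`. `κ` may be negative: the
smooth case takes `Φ = -‖·‖`. -/
theorem exists_signs_le_add_sum {E : Type*} [NormedAddCommGroup E] [NormedSpace ℝ E] (Φ : E → ℝ)
    (z : E) (g : ℕ → E) (κ : ℝ) (n : ℕ)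
    (H : ∀ m < n, ∀ ε : ℕ → ℝ, (∀ i, |ε i| = 1) →
      2 * Φ (z + ∑ i ∈ Finset.range m, ε i • g i) + 2 * κ ≤
        Φ (z + ∑ i ∈ Finset.range m, ε i • g i + g m) +
          Φ (z + ∑ i ∈ Finset.range m, ε i • g i - g m)) :
    ∃ ε : ℕ → ℝ, (∀ i, |ε i| = 1) ∧
      Φ z + n * κ ≤ Φ (z + ∑ i ∈ Finset.range n, ε i • g i) := by
  induction n with
  | zero => exact ⟨fun _ => 1, by simp, by simp⟩
  | succ n ih =>
    obtain ⟨ε, hε, h⟩ := ih fun m hm => H m (Nat.lt_succ_of_lt hm)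
    have key := H n n.lt_succ_self ε hε
    obtain ⟨c, hc, hle⟩ : ∃ c : ℝ, |c| = 1 ∧ Φ (z + ∑ i ∈ Finset.range n, ε i • g i) + κ ≤
        Φ (z + ∑ i ∈ Finset.range n, ε i • g i + c • g n) := by
      by_contra! hcon
      have h1 := hcon 1 (by simp)
      have h2 := hcon (-1) (by simp)
      rw [one_smul] at h1
      rw [neg_one_smul, ← sub_eq_add_neg] at h2
      linarith
    refine ⟨Function.update ε n c, fun i => ?_, ?_⟩
    · rcases eq_or_ne i n with rfl | hi
      · rwa [Function.update_self]
      · rw [Function.update_of_ne hi]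
        exact hε i
    · have hsum : ∑ i ∈ Finset.range n, Function.update ε n c i • g i =
          ∑ i ∈ Finset.range n, ε i • g i :=
        Finset.sum_congr rfl fun i hi => by
          rw [Function.update_of_ne (Finset.mem_range.1 hi).ne]
      rw [Finset.sum_range_succ, hsum, Function.update_self, ← add_assoc]
      push_cast
      linarith

end Signs

/-! ### Bounds on the exponent -/

section LpExponent

open MeasureTheory

variable {Ω : Type*} [MeasurableSpace Ω] {μ : Measure Ω} {p : ENNReal} [Fact (1 ≤ p)]

theorem norm_add_signed_sum_rpow (hp : p ≠ ⊤) {z : Lp ℝ p μ} {g : ℕ → Lp ℝ p μ} {t : ℝ}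
    (ht : 0 ≤ t) {n : ℕ} (hz : ∀ i < n, LpDisjoint z (g i)) (hg1 : ∀ i, ‖g i‖ = 1)
    (hg : Pairwise fun i j => LpDisjoint (g i) (g j)) {ε : ℕ → ℝ} (hε : ∀ i, |ε i| = 1) :
    ‖z + ∑ i ∈ Finset.range n, ε i • t • g i‖ ^ p.toReal =
      ‖z‖ ^ p.toReal + n * t ^ p.toReal := by
  rw [norm_add_sum_rpow_of_lpDisjoint hp
    (fun i hi => ((hz i (Finset.mem_range.1 hi)).smul_right t).smul_right (ε i))
    fun i _ j _ hij =>
      (((((hg hij).smul_right t).smul_right (ε j)).symm.smul_right t).smul_right (ε i)).symm]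
  have : ∀ i, ‖ε i • t • g i‖ = t := fun i => by
    rw [norm_smul, norm_smul, hg1, Real.norm_eq_abs, hε, Real.norm_of_nonneg ht, one_mul, mul_one]
  simp [this]

theorem norm_signed_sum_le {g : ℕ → Lp ℝ p μ} {t : ℝ} (ht : 0 ≤ t) {m n : ℕ} (hmn : m ≤ n)
    (hn : 0 < n) (hg1 : ∀ i, ‖g i‖ = 1) (hg : Pairwise fun i j => LpDisjoint (g i) (g j))
    {ε : ℕ → ℝ} (hε : ∀ i, |ε i| = 1) :
    ‖∑ i ∈ Finset.range m, ε i • t • g i‖ ≤ t * (n : ℝ) ^ (p.toReal)⁻¹ := by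
  have hn' : (0 : ℝ) < n := Nat.cast_pos.2 hn
  by_cases hp : p = ⊤
  · subst hp
    -- At `p = ⊤` the convention `toReal ⊤ = 0` turns the bound into `t`, the right one for a sup
    -- norm.
    rw [ENNReal.toReal_top, inv_zero, Real.rpow_zero, mul_one]
    clear hmn
    induction m with
    | zero => simpa using ht
    | succ m ih =>
      rw [Finset.sum_range_succ, add_comm]
      have hdis : LpDisjoint (ε m • t • g m) (∑ i ∈ Finset.range m, ε i • t • g i) :=
        LpDisjoint.sum_right fun i hi =>
          ((((hg (Finset.mem_range.1 hi).ne).smul_right t).smul_right (ε m)).symm.smul_right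
            t).smul_right (ε i)
      refine hdis.norm_add_le_max.trans (max_le ?_ ih)
      rw [norm_smul, norm_smul, hg1, Real.norm_eq_abs, hε, Real.norm_of_nonneg ht, one_mul,
        mul_one]
  · have hq : 0 < p.toReal :=
      ENNReal.toReal_pos (zero_lt_one.trans_le (Fact.out : 1 ≤ p)).ne' hp
    have h := norm_add_signed_sum_rpow hp ht (n := m) (z := 0)
      (fun i _ => (LpDisjoint.zero_right (g i)).symm) hg1 hg hε
    rw [zero_add, norm_zero, Real.zero_rpow hq.ne', zero_add] at h
    rw [← Real.rpow_le_rpow_iff (norm_nonneg _) (by positivity) hq, h,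
      Real.mul_rpow ht (by positivity), Real.rpow_inv_rpow hn'.le hq.ne', mul_comm]
    gcongr

theorem exponent_le_two_of_strongly_midpoint_convex
    (hinf : ¬ FiniteDimensional ℝ (Lp ℝ p μ)) {G : Lp ℝ p μ → ℝ} {δ κ K : ℝ} (hδ : 0 < δ)
    (hκ : 0 < κ)
    (hG : ∀ x h, ‖x‖ ≤ δ → ‖h‖ ≤ δ → 2 * G x + κ * ‖h‖ ^ 2 ≤ G (x + h) + G (x - h))
    (hK : ∀ x, ‖x‖ ≤ δ → G x ≤ K) : p ≤ 2 := by
  by_contra! hp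
  obtain ⟨g, hg1, hg⟩ := exists_seq_lpDisjoint hinf
  set α : ℝ := (p.toReal)⁻¹ with hα
  have hα2 : 0 < 1 - 2 * α := by
    by_cases hpt : p = ⊤
    · simp [hα, hpt]
    · have h2 : 2 < p.toReal := by
        have := (ENNReal.toReal_lt_toReal ENNReal.ofNat_ne_top hpt).2 hp
        simpa using this
      have : α < 2⁻¹ := inv_strictAnti₀ two_pos h2
      linarith
  have hbound : ∀ n : ℕ, 0 < n → κ * δ ^ 2 / 2 * (n : ℝ) ^ (1 - 2 * α) ≤ K - G 0 := by
    intro n hn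
    have hn' : (0 : ℝ) < n := Nat.cast_pos.2 hn
    have hn1 : (1 : ℝ) ≤ n := Nat.one_le_cast.2 hn
    -- This step size keeps every signed partial sum within norm `δ`.
    set t : ℝ := δ * (n : ℝ) ^ (-α) with ht
    have ht0 : 0 ≤ t := by positivity
    have htδ : t * (n : ℝ) ^ α = δ := by
      rw [ht, mul_assoc, ← Real.rpow_add hn', neg_add_cancel, Real.rpow_zero, mul_one]
    have hα0 : 0 ≤ α := inv_nonneg.2 ENNReal.toReal_nonneg
    have htle : t ≤ δ := by
      rw [← htδ]
      exact le_mul_of_one_le_right ht0 (Real.one_le_rpow hn1 hα0)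
    have hnt : ∀ i, ‖t • g i‖ = t := fun i => by
      rw [norm_smul, hg1, Real.norm_of_nonneg ht0, mul_one]
    have hsum : ∀ m ≤ n, ∀ ε : ℕ → ℝ, (∀ i, |ε i| = 1) →
        ‖(0 : Lp ℝ p μ) + ∑ i ∈ Finset.range m, ε i • t • g i‖ ≤ δ := fun m hm ε hε => by
      rw [zero_add, ← htδ]
      exact norm_signed_sum_le ht0 hm hn hg1 hg hε
    obtain ⟨ε, hε, h⟩ := exists_signs_le_add_sum G 0 (fun i => t • g i) (κ * t ^ 2 / 2) n
      fun m hm ε hε => by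
        have := hG _ (t • g m) (hsum m hm.le ε hε) ((hnt m).trans_le htle)
        rw [hnt] at this
        linarith
    have h2 := hK _ (hsum n le_rfl ε hε)
    have h3 : n * (κ * t ^ 2 / 2) = κ * δ ^ 2 / 2 * (n : ℝ) ^ (1 - 2 * α) := by
      have : (n : ℝ) ^ (1 - 2 * α) = n * ((n : ℝ) ^ (-α)) ^ 2 := by
        rw [← Real.rpow_natCast, ← Real.rpow_mul hn'.le, ← Real.rpow_one_add' hn'.le]
        · congr 1
          push_cast
          ring
        · push_cast
          linarith
      rw [this, ht]
      ring
    linarith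
  have hlim : Tendsto (fun n : ℕ => κ * δ ^ 2 / 2 * (n : ℝ) ^ (1 - 2 * α)) atTop atTop :=
    ((tendsto_rpow_atTop hα2).comp tendsto_natCast_atTop_atTop).const_mul_atTop (by positivity)
  obtain ⟨n, hn, hn0⟩ := ((hlim.eventually_gt_atTop (K - G 0)).and (eventually_gt_atTop 0)).exists
  exact hn.not_ge (hbound n hn0)

/-- The pieces `q i` of `z` on the supports of the `g i` are disjoint, so their `p`-th powers are
summable. Removing a window of late pieces changes `z` little, and `k` does not depend on the
window's length. -/
theorem exists_close_lpDisjoint (hp : p ≠ ⊤) {g : ℕ → Lp ℝ p μ}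
    (hg : Pairwise fun i j => LpDisjoint (g i) (g j)) (z : Lp ℝ p μ) {η : ℝ} (hη : 0 < η) :
    ∃ k : ℕ, ∀ n : ℕ, ∃ z' : Lp ℝ p μ, ‖z' - z‖ ≤ η ∧ ‖z'‖ ≤ ‖z‖ ∧
      ∀ i < n, LpDisjoint z' (g (k + i)) := by
  have hq : 0 < p.toReal :=
    ENNReal.toReal_pos (zero_lt_one.trans_le (Fact.out : 1 ≤ p)).ne' hp
  have hmeas : ∀ i, MeasurableSet {x | g i x ≠ 0} := fun i =>
    ((Lp.stronglyMeasurable (g i)).measurable (measurableSet_singleton 0)).compl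
  choose q hq_ind using fun i => Lp.exists_ae_eq_indicator z (hmeas i)
  have hqg : ∀ i j, i ≠ j → LpDisjoint (q i) (g j) := fun i j hij => by
    filter_upwards [hq_ind i, hg hij] with x h1 h2
    refine h2.imp_left fun h => ?_
    rw [h1, indicator_of_notMem (by simpa using h)]
  have hqq : ∀ i j, i ≠ j → LpDisjoint (q i) (q j) := fun i j hij => by
    filter_upwards [hq_ind j, hqg i j hij] with x h1 h2
    refine h2.imp_right fun h => ?_
    rw [h1, indicator_of_notMem (by simpa using h)]
  have hzg : ∀ i, LpDisjoint (g i) (z - q i) := fun i => by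
    filter_upwards [hq_ind i, Lp.coeFn_sub z (q i)] with x h1 h2
    refine or_iff_not_imp_left.2 fun h => ?_
    rw [h2, Pi.sub_apply, h1, indicator_of_mem (by simpa using h), sub_self]
  have hzq : ∀ i, LpDisjoint (q i) (z - q i) := fun i => by
    filter_upwards [hq_ind i, hzg i] with x h1 h2
    refine h2.imp_left fun h => ?_
    rw [h1, indicator_of_notMem (by simpa using h)]
  have herase : ∀ (s : Finset ℕ) (j : ℕ), j ∈ s →
      z - ∑ i ∈ s, q i = (z - q j) + -∑ i ∈ s.erase j, q i := fun s j hj => by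
    rw [← Finset.add_sum_erase s q hj]
    abel
  have hdis : ∀ (s : Finset ℕ) (j : ℕ), j ∈ s → ∀ w : Lp ℝ p μ, LpDisjoint w (z - q j) →
      (∀ i, i ≠ j → LpDisjoint w (q i)) → LpDisjoint (z - ∑ i ∈ s, q i) w := by
    intro s j hj w hw hwq
    rw [herase s j hj]
    exact (hw.add_right
      (LpDisjoint.sum_right fun i hi => hwq i (Finset.ne_of_mem_erase hi)).neg_right).symm
  have hpair : ∀ s : Finset ℕ, (s : Set ℕ).Pairwise fun i j => LpDisjoint (q i) (q j) :=
    fun s i _ j _ hij => hqq i j hij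
  have hnorm : ∀ s : Finset ℕ, ‖z‖ ^ p.toReal =
      ‖z - ∑ i ∈ s, q i‖ ^ p.toReal + ∑ i ∈ s, ‖q i‖ ^ p.toReal := fun s => by
    rw [← norm_add_sum_rpow_of_lpDisjoint hp
      (fun j hj => hdis s j hj (q j) (hzq j) fun i hi => hqq j i hi.symm) (hpair s),
      sub_add_cancel]
  have hnonneg : ∀ i, 0 ≤ ‖q i‖ ^ p.toReal := fun i => by positivity
  have hsummable : Summable fun i => ‖q i‖ ^ p.toReal :=
    summable_of_sum_le (c := ‖z‖ ^ p.toReal) hnonneg fun s => by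
      rw [hnorm s]
      exact le_add_of_nonneg_left (by positivity)
  obtain ⟨s, hs⟩ := summable_iff_vanishing_norm.1 hsummable (η ^ p.toReal) (by positivity)
  -- Starting past all of `s` makes the window disjoint from `s`, as the Cauchy criterion requires.
  refine ⟨s.sup id + 1, fun n => ?_⟩
  set k := s.sup id + 1 with hk
  set t := Finset.Ico k (k + n) with ht
  have hts : Disjoint t s := Finset.disjoint_left.2 fun i hi his => by
    have h1 : i ≤ s.sup id := Finset.le_sup (f := id) his
    have h2 := (Finset.mem_Ico.1 hi).1
    omega
  refine ⟨z - ∑ i ∈ t, q i, ?_, ?_, fun i hi => ?_⟩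
  · have h1 := norm_add_sum_rpow_of_lpDisjoint hp (z := 0)
      (fun i (_ : i ∈ t) => (LpDisjoint.zero_right (q i)).symm) (hpair t)
    rw [zero_add, norm_zero, Real.zero_rpow hq.ne', zero_add] at h1
    have h2 := (le_abs_self _).trans (hs t hts).le
    rw [sub_sub_cancel_left, norm_neg, ← Real.rpow_le_rpow_iff (norm_nonneg _) hη.le hq, h1]
    exact h2
  · rw [← Real.rpow_le_rpow_iff (norm_nonneg _) (norm_nonneg _) hq, hnorm t]
    exact le_add_of_nonneg_right (Finset.sum_nonneg fun i _ => hnonneg i)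
  · exact hdis t (k + i) (Finset.mem_Ico.2 ⟨by omega, by omega⟩) _ (hzg _)
      fun j hj => (hqg j _ hj).symm

/-- Bernoulli's inequality at `-b / (a + b)`. -/
theorem rpow_add_sub_rpow_le {a b q : ℝ} (ha : 0 ≤ a) (hq : 1 ≤ q)
    (hab : 0 < a + b) : (a + b) ^ q - a ^ q ≤ q * b * (a + b) ^ (q - 1) := by
  have hs : -1 ≤ -b / (a + b) := by
    rw [le_div_iff₀ hab]
    linarith
  have h := one_add_mul_self_le_rpow_one_add hs hq
  have h1 : 1 + -b / (a + b) = a / (a + b) := by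
    field_simp
    ring
  have hpow : 0 < (a + b) ^ q := Real.rpow_pos_of_pos hab q
  rw [h1, Real.div_rpow ha hab.le, le_div_iff₀ hpow] at h
  have h2 : (1 + q * (-b / (a + b))) * (a + b) ^ q =
      (a + b) ^ q - q * b * (a + b) ^ (q - 1) := by
    rw [Real.rpow_sub_one hab.ne']
    field_simp
    ring
  linarith

theorem two_le_exponent_of_norm_add_add_norm_sub_le
    (hinf : ¬ FiniteDimensional ℝ (Lp ℝ p μ)) {z : Lp ℝ p μ} {δ L : ℝ} (hδ : 0 < δ) (hL : 0 ≤ L)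
    (H : ∀ x h : Lp ℝ p μ, ‖x - z‖ ≤ δ → ‖h‖ ≤ δ →
      ‖x + h‖ + ‖x - h‖ ≤ 2 * ‖x‖ + 2 * L * ‖h‖ ^ 2) : 2 ≤ p := by
  by_contra! hp2
  have hp : p ≠ ⊤ := hp2.ne_top
  obtain ⟨g, hg1, hg⟩ := exists_seq_lpDisjoint hinf
  set r : ℝ := p.toReal with hr
  have hr1 : 1 ≤ r := by
    have := (ENNReal.toReal_le_toReal ENNReal.one_ne_top hp).2 (Fact.out : 1 ≤ p)
    simpa using this
  have hr0 : 0 < r := one_pos.trans_le hr1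
  have hr2 : r < 2 := by
    have := (ENNReal.toReal_lt_toReal hp ENNReal.ofNat_ne_top).2 hp2
    simpa using this
  -- Half of `δ` is spent on replacing `z` by `z'`, half on the signed partial sums.
  obtain ⟨k, hk⟩ := exists_close_lpDisjoint hp hg z (half_pos hδ)
  set η : ℕ → ℝ := fun n => L * (δ / 2) ^ 2 * (n : ℝ) ^ (-(2 * r⁻¹ - 1)) with hη
  have hη0 : ∀ n, 0 ≤ η n := fun n => by positivity
  -- The signs let the norm grow by at most `n * L * t ^ 2 = η n`, while disjointness makes its
  -- `r`-th power grow by exactly `n * t ^ r = (δ / 2) ^ r`. As `r < 2`, `η n` tends to 0.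
  have hbound : ∀ n : ℕ, 0 < n → (δ / 2) ^ r ≤ r * η n * (‖z‖ + η n) ^ (r - 1) := by
    intro n hn
    have hn' : (0 : ℝ) < n := Nat.cast_pos.2 hn
    have hn1 : (1 : ℝ) ≤ n := Nat.one_le_cast.2 hn
    obtain ⟨z', hz'z, hz'le, hz'g⟩ := hk n
    have hg1' : ∀ i, ‖g (k + i)‖ = 1 := fun i => hg1 _
    have hg' : Pairwise fun i j => LpDisjoint (g (k + i)) (g (k + j)) := fun i j hij =>
      hg (by omega)
    set t : ℝ := δ / 2 * (n : ℝ) ^ (-r⁻¹) with ht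
    have ht0 : 0 ≤ t := by positivity
    have htδ : t * (n : ℝ) ^ r⁻¹ = δ / 2 := by
      rw [ht, mul_assoc, ← Real.rpow_add hn', neg_add_cancel, Real.rpow_zero, mul_one]
    have htle : t ≤ δ := by
      have : t ≤ δ / 2 := by
        rw [← htδ]
        exact le_mul_of_one_le_right ht0 (Real.one_le_rpow hn1 (by positivity))
      linarith
    have hnt : ∀ i, ‖t • g (k + i)‖ = t := fun i => by
      rw [norm_smul, hg1, Real.norm_of_nonneg ht0, mul_one]
    obtain ⟨ε, hε, h⟩ := exists_signs_le_add_sum (fun x => -‖x‖) z' (fun i => t • g (k + i))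
      (-(L * t ^ 2)) n fun m hm ε hε => by
        have hsum := norm_signed_sum_le ht0 hm.le hn hg1' hg' hε
        rw [← hr, htδ] at hsum
        have hx : ‖z' + ∑ i ∈ Finset.range m, ε i • t • g (k + i) - z‖ ≤ δ := by
          rw [add_sub_right_comm]
          linarith [norm_add_le (z' - z) (∑ i ∈ Finset.range m, ε i • t • g (k + i))]
        have := H _ (t • g (k + m)) hx ((hnt m).trans_le htle)
        rw [hnt] at this
        linarith
    have hpow := norm_add_signed_sum_rpow hp ht0 hz'g hg1' hg' hε
    rw [← hr] at hpow
    have h1 : (n : ℝ) * t ^ r = (δ / 2) ^ r := by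
      rw [← htδ, Real.mul_rpow ht0 (by positivity), Real.rpow_inv_rpow hn'.le hr0.ne', mul_comm]
    have h2 : n * (L * t ^ 2) = η n := by
      have : (n : ℝ) ^ (-(2 * r⁻¹ - 1)) = n * ((n : ℝ) ^ (-r⁻¹)) ^ 2 := by
        rw [← Real.rpow_natCast, ← Real.rpow_mul hn'.le]
        nth_rewrite 2 [← Real.rpow_one (n : ℝ)]
        rw [← Real.rpow_add hn']
        congr 1
        push_cast
        ring
      rw [hη, ht]
      simp only [this]
      ring
    have h3 : ‖z' + ∑ i ∈ Finset.range n, ε i • t • g (k + i)‖ ≤ ‖z'‖ + η n := by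
      linarith
    have h4 := Real.rpow_le_rpow (norm_nonneg _) h3 hr0.le
    rw [hpow, h1] at h4
    have hδr : 0 < (δ / 2) ^ r := by positivity
    have hpos : 0 < ‖z'‖ + η n := by
      rcases (add_nonneg (norm_nonneg z') (hη0 n)).eq_or_lt with h0 | h0
      · rw [← h0, Real.zero_rpow hr0.ne'] at h4
        have : 0 ≤ ‖z'‖ ^ r := by positivity
        linarith
      · exact h0
    have h5 := rpow_add_sub_rpow_le (norm_nonneg z') hr1 hpos
    calc (δ / 2) ^ r ≤ r * η n * (‖z'‖ + η n) ^ (r - 1) := by linarith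
      _ ≤ r * η n * (‖z‖ + η n) ^ (r - 1) := by
        have := hη0 n
        have : 0 ≤ r - 1 := by linarith
        gcongr
  have hexp : 0 < 2 * r⁻¹ - 1 := by
    have : (2 : ℝ)⁻¹ < r⁻¹ := inv_strictAnti₀ hr0 hr2
    linarith
  have hηlim : Tendsto η atTop (𝓝 0) := by
    have := ((tendsto_rpow_neg_atTop hexp).comp tendsto_natCast_atTop_atTop).const_mul
      (L * (δ / 2) ^ 2)
    rwa [mul_zero] at this
  have hlim : Tendsto (fun n => r * η n * (‖z‖ + η n) ^ (r - 1)) atTop (𝓝 0) := by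
    have h1 := (hηlim.const_mul r).mul
      ((hηlim.const_add ‖z‖).rpow_const (p := r - 1) (Or.inr (by linarith)))
    simpa using h1
  obtain ⟨n, hn, hn0⟩ := ((hlim.eventually_lt_const (show 0 < (δ / 2) ^ r by positivity)).and
    (eventually_gt_atTop 0)).exists
  exact hn.not_ge (hbound n hn0)

end LpExponent

theorem mainTheorem1 {X : Type*} [NormedAddCommGroup X] [NormedSpace ℝ X] [CompleteSpace X]
    (C : Set X) (hC : IsClosed C) (x₀ : X) (hx₀ : x₀ ∉ C) (y : X) (hy : y ∈ C)
    (r₀ : ℝ) (hr₀ : 0 < r₀) (L : ℝ) (hL : 0 < L)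
    (hf : HasLipschitzDerivOn (fun x : X => ‖x - y‖) L (Metric.ball x₀ r₀)) :
    (∀ z ∈ Metric.ball (x₀ - y) r₀, NormLipschitzSmoothAt z) ∧
    ((∃ F : X → ℝ, HasStronglyMonotoneDerivOn F L (Metric.ball x₀ r₀)) →
      (∃ N : Seminorm ℝ X, IsEquivalentNorm N ∧ IsTwoUniformlyConvex N) ∧
      (∀ (Ω : Type*) [MeasurableSpace Ω] (μ : MeasureTheory.Measure Ω) (p : ENNReal)
        [Fact (1 ≤ p)], Nonempty (X ≃ₗᵢ[ℝ] MeasureTheory.Lp ℝ p μ) →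
          ¬ FiniteDimensional ℝ X → p = 2)) := by
  have hnorm : HasLipschitzDerivOn (fun x : X => ‖x‖) L (ball (x₀ - y) r₀) :=
    hf.comp_sub_const (f := fun x : X => ‖x‖)
  refine ⟨fun z hz => normLipschitzSmoothAt_of_hasLipschitzDerivOn hL isOpen_ball hnorm hz, ?_⟩
  rintro ⟨F, hF⟩
  refine ⟨hF.exists_isTwoUniformlyConvex hL hr₀, ?_⟩
  rintro Ω _ μ p _ ⟨e⟩ hX
  have hinf : ¬ FiniteDimensional ℝ (MeasureTheory.Lp ℝ p μ) := fun h =>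
    hX (Module.Finite.equiv e.symm.toLinearEquiv)
  refine le_antisymm ?_ ?_
  · have hcont : ContinuousAt F x₀ := (hF.1 x₀ (mem_ball_self hr₀)).continuousAt
    obtain ⟨δ₀, hδ₀, hδ₀F⟩ := nhds_basis_closedBall.mem_iff.1
      (hcont.eventually (gt_mem_nhds (lt_add_one (F x₀))))
    have hmem : ∀ v : X, ‖v‖ < r₀ → x₀ + v ∈ ball x₀ r₀ := fun v hv => by
      simpa [mem_ball_iff_norm] using hv
    -- `r₀ / 3` keeps `x ± h` in the ball; `δ₀` bounds `F` above by continuity.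
    refine exponent_le_two_of_strongly_midpoint_convex hinf (G := fun v => F (x₀ + e.symm v))
      (δ := min δ₀ (r₀ / 3)) (K := F x₀ + 1) (by positivity) hL (fun x h hx hh => ?_)
      fun x hx => ?_
    · have hx' : ‖e.symm x‖ ≤ r₀ / 3 := by
        rw [e.symm.norm_map]
        exact hx.trans (min_le_right _ _)
      have hh' : ‖e.symm h‖ ≤ r₀ / 3 := by
        rw [e.symm.norm_map]
        exact hh.trans (min_le_right _ _)
      have h1 := hF.two_mul_add_le (convex_ball x₀ r₀) (x := x₀ + e.symm x) (h := e.symm h)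
        (hmem _ (by linarith))
        (by rw [add_assoc]; exact hmem _ (by linarith [norm_add_le (e.symm x) (e.symm h)]))
        (by rw [add_sub_assoc]; exact hmem _ (by linarith [norm_sub_le (e.symm x) (e.symm h)]))
      rw [e.symm.norm_map] at h1
      simpa only [map_add, map_sub, add_assoc, add_sub_assoc] using h1
    · refine (show F (x₀ + e.symm x) < F x₀ + 1 from hδ₀F ?_).le
      rw [mem_closedBall_iff_norm, add_sub_cancel_left, e.symm.norm_map]
      exact hx.trans (min_le_left _ _)
  · refine two_le_exponent_of_norm_add_add_norm_sub_le hinf (z := e (x₀ - y)) (δ := r₀ / 3)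
      (by positivity) hL.le fun x h hx hh => ?_
    have hx' : ‖e.symm x - (x₀ - y)‖ ≤ r₀ / 3 := by
      rwa [← e.norm_map, map_sub, e.apply_symm_apply]
    have h1 := norm_add_add_norm_sub_le hL.le hnorm (z := e.symm x) (h := e.symm h) fun v hv => by
      rw [mem_closedBall_iff_norm, e.symm.norm_map] at hv
      rw [mem_ball_iff_norm, show v - (x₀ - y) = (v - e.symm x) + (e.symm x - (x₀ - y)) by abel]
      linarith [norm_add_le (v - e.symm x) (e.symm x - (x₀ - y))]
    rwa [← map_add, ← map_sub, e.symm.norm_map, e.symm.norm_map, e.symm.norm_map,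
      e.symm.norm_map] at h1
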